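/- Notation. Let $d\ge 0$ and $N\ge 0$ be integers and let $\rho\in\mathbb R^d$ with $0<\rho_1,\dots,\rho_d<1$ and $|\rho|=\rho_1+\dots+\rho_d<1$; put $\boldsymbol\rho=(\rho,1-|\rho|)\in\mathbb R^{d+1}$. For $m\in\mathbb N_0$ let $\mathbb Z_m^{d+1}=\{\alpha\in\mathbb N_0^{d+1}: |\alpha|=\alpha_1+\dots+\alpha_{d+1}=m\}$. Write $(a)_k=a(a+1)\cdots(a+k-1)$, $(-x)_\alpha=\prod_{i=1}^{d+1}(-x_i)_{\alpha_i}$, $\alpha!=\prod_i\alpha_i!$ and $\boldsymbol\rho^\alpha=\prod_i\boldsymbol\rho_i^{\alpha_i}$. On real functions on $\mathbb Z_N^{d+1}$ consider the Krawtchouk inner product $$\langle f,g\rangle_{\mathsf K_{\rho,N}}=N!\sum_{x\in\mathbb Z_N^{d+1}}f(x)\,g(x)\,\frac{\boldsymbol\rho^x}{x!}.$$ Let $\Pi_n^d$ be the space of polynomials of total degree at most $n$ in $x_1,\dots,x_d$, regarded as functions on $\mathbb Z_N^{d+1}$, and let $\mathcal V_n^d(\mathsf K_{\rho,N})$ be the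 space of those $f\in\Pi_n^d$ that are orthogonal to all polynomials of degree less than $n$. Let $\mathsf P_n(\mathsf K_{\rho,N};\cdot,\cdot)$ be the reproducing kernel of $\mathcal V_n^d(\mathsf K_{\rho,N})$: for every $x$ the function $\mathsf P_n(\mathsf K_{\rho,N};x,\cdot)$ lies in $\mathcal V_n^d(\mathsf K_{\rho,N})$, and $\langle \mathsf P_n(\mathsf K_{\rho,N};x,\cdot),f\rangle_{\mathsf K_{\rho,N}}=f(x)$ for all $f\in\mathcal V_n^d(\mathsf K_{\rho,N})$. For $\alpha\in\mathbb N_0^{d+1}$ with $n\le|\alpha|\le N$ let $\mathrm m_\alpha(x)=(-1)^{|\alpha|}(-x)_\alpha$ and $$\mathsf L_{\alpha,n}(\cdot;\rho,N)=\frac1{\boldsymbol\rho^\alpha}\,\mathrm{proj}_{\mathcal V_n^d(\mathsf K_{\rho,N})}\,\mathrm m_\alpha ,$$ where $\mathrm{proj}$ is the orthogonal projection. Theorem. For all integers $0\le n\le m\le N$ and all $x,y\in\mathbb Z_N^{d+1}$, $$\mathsf P_n(\mathsf K_{\rho,N};x,y)=\frac{(-N)_n\,m!}{(-m)_n\,[(-N)_m]^2}\sum_{\alpha\in\mathbb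 Z_m^{d+1}}\frac{\boldsymbol\rho^\alpha}{\alpha!}\,\mathsf L_{\alpha,n}(x;\rho,N)\,\mathsf L_{\alpha,n}(y;\rho,N).$$ -/

import Mathlib

noncomputable section

namespace Krawtchouk

open scoped InnerProductSpace

/-- The parameters `ρ = (ρ₁, …, ρ_d)` with `0 < ρ_i < 1` and `|ρ| < 1`. -/
def params (d : ℕ) : Set (Fin d → ℝ) :=
  {ρ | (∀ i, 0 < ρ i ∧ ρ i < 1) ∧ ∑ i, ρ i < 1}

/-- The extended parameter `𝛒 = (ρ, 1 - |ρ|) ∈ ℝ^{d+1}`. -/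
def bold {d : ℕ} (ρ : params d) : Fin (d + 1) → ℝ :=
  Fin.snoc (α := fun _ => ℝ) ρ.1 (1 - ∑ i, ρ.1 i)

/-- The multi-indices `α ∈ ℕ₀^{d+1}` with `|α| = m`. -/
abbrev indices (d m : ℕ) : Finset (Fin (d + 1) → ℕ) :=
  Finset.Nat.antidiagonalTuple (d + 1) m

/-- The power `𝛒 ^ α`. -/
def rhoPow {d : ℕ} (ρ : params d) (α : Fin (d + 1) → ℕ) : ℝ :=
  ∏ i, bold ρ i ^ α i

/-- The factorial `α ! = α₁ ! ⋯ α_{d+1} !`, as a real number. -/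
def multiFactorial {d : ℕ} (α : Fin (d + 1) → ℕ) : ℝ :=
  ∏ i, (Nat.factorial (α i) : ℝ)

/-- The Pochhammer symbol `(a)_n = a (a + 1) ⋯ (a + n - 1)`. -/
def poch (a : ℝ) (n : ℕ) : ℝ := (ascPochhammer ℝ n).eval a

/-- The normalized Krawtchouk (multinomial) weight `N! 𝛒 ^ x / x !`. -/
def weight {d : ℕ} (ρ : params d) (N : ℕ) (x : Fin (d + 1) → ℕ) : ℝ :=
  (Nat.factorial N : ℝ) * (rhoPow ρ x / multiFactorial x)

lemma bold_pos {d : ℕ} (ρ : params d) (i : Fin (d + 1)) : 0 < bold ρ i := by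
  refine Fin.lastCases ?_ (fun j => ?_) i
  · simpa [bold] using ρ.2.2
  · simpa [bold] using (ρ.2.1 j).1

lemma weight_pos {d : ℕ} (ρ : params d) (N : ℕ) (x : Fin (d + 1) → ℕ) :
    0 < weight ρ N x := by
  have h1 : 0 < rhoPow ρ x := Finset.prod_pos fun i _ => pow_pos (bold_pos ρ i) _
  have h2 : 0 < multiFactorial x :=
    Finset.prod_pos fun i _ => by exact_mod_cast Nat.factorial_pos _
  unfold weight
  positivity

/-- The space of real functions on the lattice points `x ∈ ℕ₀^{d+1}`, `|x| = N`. It carries the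
Krawtchouk inner product below. -/
def FunSpace {d : ℕ} (_ρ : params d) (N : ℕ) : Type := indices d N → ℝ

variable {d : ℕ} (ρ : params d) (N : ℕ)

instance : AddCommGroup (FunSpace ρ N) := inferInstanceAs (AddCommGroup (indices d N → ℝ))

instance : Module ℝ (FunSpace ρ N) := inferInstanceAs (Module ℝ (indices d N → ℝ))

instance : FiniteDimensional ℝ (FunSpace ρ N) :=
  inferInstanceAs (FiniteDimensional ℝ (indices d N → ℝ))

instance : CoeFun (FunSpace ρ N) (fun _ => indices d N → ℝ) := ⟨fun f => f⟩

/-- The Krawtchouk inner product `⟨f, g⟩ = N! ∑_{|x| = N} f(x) g(x) 𝛒 ^ x / x !`. -/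
@[reducible] def innerCore : InnerProductSpace.Core ℝ (FunSpace ρ N) where
  inner f g := ∑ x : indices d N, f x * g x * weight ρ N x.1
  conj_inner_symm f g := by simp [mul_comm (f _)]
  re_inner_nonneg f := by
    simp only [RCLike.re_to_real]
    exact Finset.sum_nonneg fun x _ =>
      mul_nonneg (mul_self_nonneg _) (weight_pos ρ N x.1).le
  add_left f g h := by
    rw [← Finset.sum_add_distrib]
    refine Finset.sum_congr rfl fun x _ => ?_
    change (f x + g x) * h x * _ = _
    ring
  smul_left f g r := by
    rw [Finset.mul_sum]
    refine Finset.sum_congr rfl fun x _ => ?_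
    change (r * f x) * g x * _ = r * _
    ring
  definite f hf := by
    funext x
    have h := (Finset.sum_eq_zero_iff_of_nonneg (fun y _ =>
      mul_nonneg (mul_self_nonneg (f y)) (weight_pos ρ N y.1).le)).1 hf x (Finset.mem_univ x)
    change f x = 0
    simpa [(weight_pos ρ N x.1).ne'] using h

instance : NormedAddCommGroup (FunSpace ρ N) :=
  (innerCore ρ N).toNormedAddCommGroup

instance : InnerProductSpace ℝ (FunSpace ρ N) :=
  InnerProductSpace.ofCore (innerCore ρ N).toCore

lemma inner_def (f g : FunSpace ρ N) :
    ⟪f, g⟫_ℝ = ∑ x : indices d N, f x * g x * weight ρ N x.1 := rfl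

/-- Restriction of a polynomial in the `d` variables `x₁, …, x_d` to the lattice points
`x = (x₁, …, x_d, x_{d+1})`, `|x| = N`. -/
def evalPoly : MvPolynomial (Fin d) ℝ →ₗ[ℝ] FunSpace ρ N where
  toFun p := fun x => MvPolynomial.eval (fun i : Fin d => (x.1 i.castSucc : ℝ)) p
  map_add' p q := by funext x; exact map_add _ p q
  map_smul' r p := by funext x; exact MvPolynomial.smul_eval _ p r

/-- The space `Π_n^d` of polynomials of total degree at most `n` in `d` variables, as functions
on the lattice. -/
def polySpace (n : ℕ) : Submodule ℝ (FunSpace ρ N) :=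
  (MvPolynomial.restrictTotalDegree (Fin d) ℝ n).map (evalPoly ρ N)

/-- The space `𝒱_n^d(K_{ρ,N})` of orthogonal polynomials of degree `n`: the elements of `Π_n^d`
orthogonal to all polynomials of degree less than `n`. -/
def orthoSpace (n : ℕ) : Submodule ℝ (FunSpace ρ N) :=
  polySpace ρ N n ⊓ ⨅ k ∈ Set.Iio n, (polySpace ρ N k)ᗮ

/-- The monic shifted monomial `m_α(x) = (-1)^{|α|} (-x)_α` on the lattice. -/
def monicMonomial (α : Fin (d + 1) → ℕ) : FunSpace ρ N :=
  fun x => (-1) ^ (∑ i, α i) * ∏ i, poch (-(x.1 i : ℝ)) (α i)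

/-- `L_{α,n}(·; ρ, N) = 𝛒 ^ {-α} proj_{𝒱_n^d(K_{ρ,N})} m_α`. -/
def L (α : Fin (d + 1) → ℕ) (n : ℕ) : FunSpace ρ N :=
  (rhoPow ρ α)⁻¹ • (orthoSpace ρ N n).starProjection (monicMonomial ρ N α)

/-- `𝒱_n^d(K_{ρ,N})` as a (finite-dimensional) reproducing kernel Hilbert space of functions on
the lattice. -/
instance orthoRKHS (n : ℕ) : RKHS ℝ (orthoSpace ρ N n) (indices d N) ℝ where
  coeCLM := LinearMap.toContinuousLinearMap
    { toFun := fun f => (f : FunSpace ρ N)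
      map_add' := fun _ _ => rfl
      map_smul' := fun _ _ => rfl }
  coeCLM_injective := fun _ _ h => Subtype.ext h

/-- The reproducing kernel `P_n(K_{ρ,N}; x, y)` of `𝒱_n^d(K_{ρ,N})`. -/
def kernel (n : ℕ) (x y : indices d N) : ℝ := RKHS.kernel (orthoSpace ρ N n) x y 1

lemma kernel_symm (n : ℕ) (x y : indices d N) : kernel ρ N n x y = kernel ρ N n y x := by
  have h := RKHS.kernel_inner (orthoSpace ρ N n) x y (1 : ℝ) (1 : ℝ)
  have h' := RKHS.kernel_inner (orthoSpace ρ N n) y x (1 : ℝ) (1 : ℝ)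
  have e := h.trans ((real_inner_comm _ _).trans h'.symm)
  simpa [kernel] using e

lemma kernel_eq_kerFun (n : ℕ) (x : indices d N) :
    (show FunSpace ρ N from fun y => kernel ρ N n x y) =
      (RKHS.kerFun (orthoSpace ρ N n) x (1 : ℝ) : orthoSpace ρ N n) := by
  funext y
  change kernel ρ N n x y = (RKHS.kerFun (orthoSpace ρ N n) x (1 : ℝ)) y
  rw [RKHS.kerFun_apply, kernel_symm]
  rfl

/-- `P_n(K_{ρ,N}; x, ·)` lies in `𝒱_n^d(K_{ρ,N})`. -/
lemma kernel_mem (n : ℕ) (x : indices d N) :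
    (show FunSpace ρ N from fun y => kernel ρ N n x y) ∈ orthoSpace ρ N n := by
  rw [kernel_eq_kerFun]
  exact Subtype.property _

/-- The reproducing property of `P_n(K_{ρ,N}; x, ·)`. -/
lemma inner_kernel (n : ℕ) (x : indices d N) (f : FunSpace ρ N) (hf : f ∈ orthoSpace ρ N n) :
    ⟪(show FunSpace ρ N from fun y => kernel ρ N n x y), f⟫_ℝ = f x := by
  rw [kernel_eq_kerFun]
  have h := RKHS.kerFun_inner (H := orthoSpace ρ N n) x (1 : ℝ) ⟨f, hf⟩
  refine Eq.trans h ?_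
  change (f x : ℝ) * 1 = f x
  exact mul_one _

end Krawtchouk

end

namespace Krawtchouk

open scoped InnerProductSpace

/-! The kernel formula is an eigenvalue statement for `sampling`, the operator S f = ∑ ⟪m_α, f⟫ m_α
/ (𝛒^α α!) over |α| = m. Since m_α is a product of falling factorials, it cancels against 1/x! in
the weight, so ⟪m_α, m_β⟫ / 𝛒^α is a combination of the falling factorials of α of orders γ ≤ β
(`inner_monicMonomial`, `falling_add_left`). Summing these against m_α / α! returns multiples of m_γ
(`sum_falling_mul_falling`). Thus S is triangular on the m_β (`sampling_monicMonomial`), with a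
diagonal entry depending only on |β|. As the m_β with |β| ≤ n span Π_n^d, projecting to 𝒱_n^d kills
the lower terms and leaves the scalar c = N!/(N-m)! · C(N-n, m-n) (`starProjection_sampling`). For f
= P_n(x, ·), the reproducing property gives ⟪m_α, f⟫ = 𝛒^α L_{α,n}(x); evaluation at y then gives c
· P_n(x, y) as the sum, and the stated prefactor is 1/c. -/

/-! ### Vandermonde and multinomial sums. -/

/-- A sum over tuples of length `k + 1` split according to the first entry. -/
lemma sum_antidiagonalTuple_succ {M : Type*} [AddCommMonoid M] (k m : ℕ)
    (f : (Fin (k + 1) → ℕ) → M) :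
    ∑ α ∈ Finset.Nat.antidiagonalTuple (k + 1) m, f α =
      ∑ p ∈ Finset.HasAntidiagonal.antidiagonal m,
        ∑ β ∈ Finset.Nat.antidiagonalTuple k p.2, f (Fin.cons p.1 β) := by
  rw [Finset.sum_sigma']
  symm
  refine Finset.sum_bij' (fun q _ => Fin.cons q.1.1 q.2)
    (fun α _ => ⟨(α 0, ∑ i : Fin k, α i.succ), Fin.tail α⟩) ?_ ?_ ?_ ?_ ?_
  · rintro ⟨⟨a, b⟩, β⟩ h
    simp only [Finset.mem_sigma, Finset.HasAntidiagonal.mem_antidiagonal, Finset.Nat.mem_antidiagonalTuple] at h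
    simp [Finset.Nat.mem_antidiagonalTuple, Fin.sum_univ_succ, h.1, h.2]
  · intro α h
    rw [Finset.Nat.mem_antidiagonalTuple, Fin.sum_univ_succ] at h
    simp [Finset.Nat.mem_antidiagonalTuple, Fin.tail, h]
  · rintro ⟨⟨a, b⟩, β⟩ h
    simp only [Finset.mem_sigma, Finset.HasAntidiagonal.mem_antidiagonal, Finset.Nat.mem_antidiagonalTuple] at h
    simp [h.2]
  · intro α _
    simp
  · intro q _
    rfl

/-- Vandermonde's identity in several variables. -/
lemma sum_prod_choose (k : ℕ) (x : Fin k → ℕ) (m : ℕ) :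
    ∑ α ∈ Finset.Nat.antidiagonalTuple k m, ∏ i, (x i).choose (α i) = (∑ i, x i).choose m := by
  induction k generalizing m with
  | zero => cases m <;> simp
  | succ k ih =>
    rw [sum_antidiagonalTuple_succ, Fin.sum_univ_succ, Nat.add_choose_eq]
    refine Finset.sum_congr rfl fun p _ => ?_
    rw [← ih, Finset.mul_sum]
    simp [Fin.prod_univ_succ]

/-- The multinomial theorem in exponential form. -/
lemma sum_prod_pow_div_factorial (k : ℕ) (r : Fin k → ℝ) (m : ℕ) :
    ∑ α ∈ Finset.Nat.antidiagonalTuple k m,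
      (∏ i, r i ^ α i) / (∏ i, (Nat.factorial (α i) : ℝ)) =
      (∑ i, r i) ^ m / (Nat.factorial m : ℝ) := by
  rw [Finset.sum_pow_eq_sum_piAntidiag, Finset.piAntidiag_univ_fin_eq_antidiagonalTuple,
    Finset.sum_div]
  refine Finset.sum_congr rfl fun α hα => ?_
  have h := Nat.multinomial_spec Finset.univ α
  rw [Finset.Nat.mem_antidiagonalTuple.1 hα] at h
  have h' : (∏ i, (Nat.factorial (α i) : ℝ)) * (Nat.multinomial Finset.univ α : ℝ) =
      (Nat.factorial m : ℝ) := by exact_mod_cast h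
  have h0 : (∏ i, (Nat.factorial (α i) : ℝ)) ≠ 0 :=
    Finset.prod_ne_zero_iff.2 fun i _ => by positivity
  rw [div_eq_div_iff h0 (by positivity), ← h']
  ring

lemma sum_bold {d : ℕ} (ρ : params d) : ∑ i, bold ρ i = 1 := by
  simp [bold, Fin.sum_univ_castSucc]

lemma rhoPow_pos {d : ℕ} (ρ : params d) (α : Fin (d + 1) → ℕ) : 0 < rhoPow ρ α :=
  Finset.prod_pos fun i _ => pow_pos (bold_pos ρ i) _

lemma multiFactorial_pos {d : ℕ} (α : Fin (d + 1) → ℕ) : 0 < multiFactorial α :=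
  Finset.prod_pos fun i _ => by positivity

lemma rhoPow_add {d : ℕ} (ρ : params d) (α β : Fin (d + 1) → ℕ) :
    rhoPow ρ (α + β) = rhoPow ρ α * rhoPow ρ β := by
  simp [rhoPow, pow_add, Finset.prod_mul_distrib]

lemma sum_rhoPow_div_multiFactorial {d : ℕ} (ρ : params d) (m : ℕ) :
    ∑ α ∈ indices d m, rhoPow ρ α / multiFactorial α = 1 / (Nat.factorial m : ℝ) := by
  have h := sum_prod_pow_div_factorial (d + 1) (bold ρ) m
  rw [sum_bold, one_pow] at h
  exact h

/-! ### Falling factorials in several variables. -/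

/-- The product of falling factorials `∏ᵢ xᵢ (xᵢ - 1) ⋯ (xᵢ - αᵢ + 1)`. -/
def falling {d : ℕ} (x α : Fin (d + 1) → ℕ) : ℝ :=
  ∏ i, ((x i).descFactorial (α i) : ℝ)

lemma poch_neg (a k : ℕ) : poch (-(a : ℝ)) k = (-1) ^ k * (a.descFactorial k : ℝ) := by
  rw [poch, ascPochhammer_eval_neg_eq_descPochhammer, descPochhammer_eval_eq_descFactorial]

lemma monicMonomial_apply {d : ℕ} (ρ : params d) (N : ℕ) (α : Fin (d + 1) → ℕ)
    (x : indices d N) : monicMonomial ρ N α x = falling x.1 α := by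
  simp only [monicMonomial, falling, poch_neg, Finset.prod_mul_distrib, Finset.prod_pow_eq_pow_sum]
  rw [← mul_assoc, ← mul_pow]
  simp

lemma descFactorial_add' (n a b : ℕ) :
    n.descFactorial (a + b) = n.descFactorial a * (n - a).descFactorial b := by
  have h := Nat.descFactorial_mul_descFactorial (n := n) (Nat.le_add_right a b)
  rw [Nat.add_sub_cancel_left] at h
  rw [← h, mul_comm]

/-- Truncation in `x - α` is harmless: it occurs only when `α ≤ x` fails, and then both sides
vanish. -/
lemma falling_add {d : ℕ} (x α β : Fin (d + 1) → ℕ) :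
    falling x (α + β) = falling x α * falling (x - α) β := by
  simp [falling, descFactorial_add', Finset.prod_mul_distrib]

lemma falling_eq_zero {d : ℕ} {x α : Fin (d + 1) → ℕ} (h : ¬ α ≤ x) : falling x α = 0 := by
  rw [Pi.le_def] at h
  push Not at h
  obtain ⟨i, hi⟩ := h
  exact Finset.prod_eq_zero (Finset.mem_univ i) (by simp [hi])

lemma falling_div_multiFactorial {d : ℕ} (x α : Fin (d + 1) → ℕ) :
    falling x α / multiFactorial α = ((∏ i, (x i).choose (α i) : ℕ) : ℝ) := by
  rw [div_eq_iff (multiFactorial_pos α).ne', falling, multiFactorial]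
  push_cast
  rw [← Finset.prod_mul_distrib]
  refine Finset.prod_congr rfl fun i _ => ?_
  rw [Nat.descFactorial_eq_factorial_mul_choose]
  push_cast
  ring

lemma falling_add_self_div {d : ℕ} (α z : Fin (d + 1) → ℕ) :
    falling (α + z) α / multiFactorial (α + z) = 1 / multiFactorial z := by
  rw [div_eq_div_iff (multiFactorial_pos _).ne' (multiFactorial_pos _).ne', one_mul, falling,
    multiFactorial, multiFactorial, ← Finset.prod_mul_distrib]
  refine Finset.prod_congr rfl fun i _ => ?_
  have h := Nat.factorial_mul_descFactorial (n := α i + z i) (k := α i) (Nat.le_add_right _ _)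
  rw [Nat.add_sub_cancel_left] at h
  rw [Pi.add_apply, ← h]
  push_cast
  ring

/-- Falling factorials against the weight `1 / x !` shift the summation variable. -/
lemma sum_falling_div_multiFactorial {d N k : ℕ} (α : Fin (d + 1) → ℕ) (hα : ∑ i, α i = k)
    (hk : k ≤ N) (h : (Fin (d + 1) → ℕ) → ℝ) :
    ∑ x ∈ indices d N, h x * (falling x α / multiFactorial x) =
      ∑ z ∈ indices d (N - k), h (α + z) * (1 / multiFactorial z) := by
  symm
  refine Finset.sum_of_injOn (fun z => α + z) (fun _ _ _ _ h => add_left_cancel h) ?_ ?_ ?_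
  · intro z hz
    simp only [Finset.mem_coe, Finset.Nat.mem_antidiagonalTuple] at hz ⊢
    simp only [Pi.add_apply, Finset.sum_add_distrib, hz, hα]
    omega
  · intro x hx hx'
    -- Points outside the shifted lattice are those without `α ≤ x`, where the falling factorial is
    -- zero.
    rw [falling_eq_zero, zero_div, mul_zero]
    intro hle
    refine hx' ⟨x - α, ?_, add_tsub_cancel_of_le hle⟩
    simp only [Finset.mem_coe, Finset.Nat.mem_antidiagonalTuple] at hx ⊢
    have : ∑ i, x i = ∑ i, α i + ∑ i, (x - α) i := by
      rw [← Finset.sum_add_distrib]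
      exact Finset.sum_congr rfl fun i _ => (add_tsub_cancel_of_le (hle i)).symm
    omega
  · intro z _
    rw [falling_add_self_div]

lemma add_descFactorial_eq_sum (a b n : ℕ) :
    (a + b).descFactorial n = ∑ k ∈ Finset.range (n + 1),
      n.choose k * (a.descFactorial k * b.descFactorial (n - k)) := by
  rw [Nat.descFactorial_eq_factorial_mul_choose, Nat.add_choose_eq,
    Finset.Nat.sum_antidiagonal_eq_sum_range_succ_mk, Finset.mul_sum]
  refine Finset.sum_congr rfl fun k hk => ?_
  rw [← Nat.choose_mul_factorial_mul_factorial (Finset.mem_range_succ_iff.1 hk),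
    Nat.descFactorial_eq_factorial_mul_choose, Nat.descFactorial_eq_factorial_mul_choose]
  ring

/-- Vandermonde in each coordinate; it separates `α` from `z` after the shift `x = α + z` in an
inner product. -/
lemma falling_add_left {d : ℕ} (a b β : Fin (d + 1) → ℕ) :
    falling (a + b) β = ∑ γ ∈ Fintype.piFinset fun i => Finset.range (β i + 1),
      ((∏ i, (β i).choose (γ i) : ℕ) : ℝ) * (falling a γ * falling b (β - γ)) := by
  simp only [falling, Pi.add_apply, add_descFactorial_eq_sum, Nat.cast_sum]
  rw [Finset.prod_univ_sum]
  refine Finset.sum_congr rfl fun γ _ => ?_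
  push_cast
  simp [Finset.prod_mul_distrib]

/-- The sum `∑_α α^{\underline γ} x^{\underline α} / α!` over `|α| = m`. -/
lemma sum_falling_mul_falling {d N m k : ℕ} (x γ : Fin (d + 1) → ℕ) (hx : ∑ i, x i = N)
    (hγ : ∑ i, γ i = k) (hk : k ≤ m) :
    ∑ α ∈ indices d m, falling x α * (falling α γ / multiFactorial α) =
      ((N - k).choose (m - k) : ℝ) * falling x γ := by
  rw [sum_falling_div_multiFactorial γ hγ hk]
  simp_rw [falling_add, mul_assoc, mul_one_div, falling_div_multiFactorial]
  rw [← Finset.mul_sum, ← Nat.cast_sum, sum_prod_choose, mul_comm]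
  -- The total of `x - γ` is `N - k` only without truncation; otherwise `falling x γ` is zero.
  by_cases h : γ ≤ x
  · have : ∑ i, x i = ∑ i, γ i + ∑ i, (x - γ) i := by
      rw [← Finset.sum_add_distrib]
      exact Finset.sum_congr rfl fun i _ => (add_tsub_cancel_of_le (h i)).symm
    rw [show ∑ i, (x - γ) i = N - k by omega]
  · simp [falling_eq_zero h]


lemma falling_add_single {d : ℕ} (x α : Fin (d + 1) → ℕ) (i : Fin (d + 1)) :
    (x i : ℝ) * falling x α = falling x (α + Pi.single i 1) + (α i : ℝ) * falling x α := by
  rw [falling_add]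
  have h : falling (x - α) (Pi.single i 1) = ((x i - α i : ℕ) : ℝ) := by
    rw [falling, Finset.prod_eq_single i]
    · simp
    · intro j _ hj
      simp [hj]
    · simp
  rw [h]
  by_cases hle : α ≤ x
  · rw [Nat.cast_sub (hle i)]
    ring
  · simp [falling_eq_zero hle]

/-! ### Shifted monomials span the polynomials on the lattice. -/

section

variable {d : ℕ} (ρ : params d) (N : ℕ)

lemma monicMonomial_mem_polySpace (α : Fin (d + 1) → ℕ) :
    monicMonomial ρ N α ∈ polySpace ρ N (∑ i, α i) := by
  -- On the lattice the last coordinate is `N - ∑ xᵢ`, so every coordinate is a polynomial of degree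
  -- at most one in `d` variables.
  let Y : Fin (d + 1) → MvPolynomial (Fin d) ℝ :=
    Fin.snoc (α := fun _ => MvPolynomial (Fin d) ℝ) MvPolynomial.X
      (MvPolynomial.C (N : ℝ) - ∑ i, MvPolynomial.X i)
  have hY : ∀ i, (Y i).totalDegree ≤ 1 := by
    intro i
    refine Fin.lastCases ?_ (fun j => ?_) i
    · simp only [Y, Fin.snoc_last]
      refine (MvPolynomial.totalDegree_sub _ _).trans (max_le (by simp only [MvPolynomial.totalDegree_C, zero_le]) ?_)
      exact MvPolynomial.totalDegree_finsetSum_le fun j _ => by simp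
    · simp [Y]
  have hYx : ∀ (x : indices d N) i,
      MvPolynomial.eval (fun j : Fin d => (x.1 j.castSucc : ℝ)) (Y i) = x.1 i := by
    intro x i
    refine Fin.lastCases ?_ (fun j => ?_) i
    · have h := Finset.Nat.mem_antidiagonalTuple.1 x.2
      rw [Fin.sum_univ_castSucc] at h
      simp [Y, ← h]
    · simp [Y]
  refine ⟨∏ i, ∏ j ∈ Finset.range (α i), (Y i - MvPolynomial.C (j : ℝ)), ?_, ?_⟩
  · rw [SetLike.mem_coe, MvPolynomial.mem_restrictTotalDegree]
    refine (MvPolynomial.totalDegree_finsetProd _ _).trans (Finset.sum_le_sum fun i _ => ?_)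
    refine (MvPolynomial.totalDegree_finsetProd _ _).trans ?_
    refine (Finset.sum_le_card_nsmul _ _ 1 fun j _ => ?_).trans (by simp)
    exact (MvPolynomial.totalDegree_sub _ _).trans 
      (max_le (hY i) (by simp only [MvPolynomial.totalDegree_C, zero_le]))
  · funext x
    rw [monicMonomial_apply]
    change MvPolynomial.eval _ _ = _
    simp only [map_prod, map_sub, hYx, MvPolynomial.eval_C, falling]
    refine Finset.prod_congr rfl fun i _ => ?_
    rw [← descPochhammer_eval_eq_descFactorial ℝ, descPochhammer_eval_eq_prod_range]

/-- The span of the monic shifted monomials of degree at most `n`. -/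
def monicSpan (n : ℕ) : Submodule ℝ (FunSpace ρ N) :=
  Submodule.span ℝ (monicMonomial ρ N '' {α | ∑ i, α i ≤ n})

variable {ρ N}

lemma monicMonomial_mem_monicSpan {n : ℕ} {α : Fin (d + 1) → ℕ} (h : ∑ i, α i ≤ n) :
    monicMonomial ρ N α ∈ monicSpan ρ N n :=
  Submodule.subset_span ⟨α, h, rfl⟩

/-- By `falling_add_single`, multiplying m_α by a coordinate yields m_α with that index raised plus
a multiple of m_α. -/
lemma evalPoly_mul_X_mem_monicSpan {n : ℕ} (i : Fin d) (p : MvPolynomial (Fin d) ℝ)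
    (hp : evalPoly ρ N p ∈ monicSpan ρ N n) :
    evalPoly ρ N (p * MvPolynomial.X i) ∈ monicSpan ρ N (n + 1) := by
  let M : FunSpace ρ N →ₗ[ℝ] FunSpace ρ N :=
    { toFun := fun f x => f x * (x.1 i.castSucc : ℝ)
      map_add' := fun f g => by funext x; exact add_mul _ _ _
      map_smul' := fun r f => by funext x; exact mul_assoc _ _ _ }
  have hM : evalPoly ρ N (p * MvPolynomial.X i) = M (evalPoly ρ N p) := by
    funext x
    change MvPolynomial.eval (fun j : Fin d => (x.1 j.castSucc : ℝ)) _ =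
      MvPolynomial.eval (fun j : Fin d => (x.1 j.castSucc : ℝ)) p * _
    rw [map_mul, MvPolynomial.eval_X]
  rw [hM]
  have key : monicSpan ρ N n ≤ (monicSpan ρ N (n + 1)).comap M := by
    refine Submodule.span_le.2 ?_
    rintro _ ⟨α, hα, rfl⟩
    have hα' : ∑ j, α j ≤ n := hα
    have e : M (monicMonomial ρ N α) = monicMonomial ρ N (α + Pi.single i.castSucc 1) +
        (α i.castSucc : ℝ) • monicMonomial ρ N α := by
      funext x
      change monicMonomial ρ N α x * _ =
        monicMonomial ρ N _ x + (α i.castSucc : ℝ) * monicMonomial ρ N α x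
      simp only [monicMonomial_apply]
      rw [mul_comm, falling_add_single]
    rw [SetLike.mem_coe, Submodule.mem_comap, e]
    refine Submodule.add_mem _ (monicMonomial_mem_monicSpan ?_)
      (Submodule.smul_mem _ _ (monicMonomial_mem_monicSpan (by omega)))
    simp [Finset.sum_add_distrib]
    exact hα'
  exact key hp

lemma evalPoly_monomial_mem_monicSpan (n : ℕ) (s : Fin d →₀ ℕ) (hs : s.degree = n) (c : ℝ) :
    evalPoly ρ N (MvPolynomial.monomial s c) ∈ monicSpan ρ N n := by
  induction n generalizing s with
  | zero =>
    obtain rfl : s = 0 := (Finsupp.degree_eq_zero_iff s).1 hs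
    have e : evalPoly ρ N (MvPolynomial.monomial 0 c) = c • monicMonomial ρ N 0 := by
      funext x
      change MvPolynomial.eval _ _ = c * monicMonomial ρ N 0 x
      simp [monicMonomial_apply, falling]
    rw [e]
    exact Submodule.smul_mem _ _ (monicMonomial_mem_monicSpan (by simp))
  | succ n ih =>
    have hs0 : s ≠ 0 := by
      rintro rfl
      simp at hs
    obtain ⟨i, hi⟩ := Finsupp.ne_iff.1 hs0
    have hle : Finsupp.single i 1 ≤ s := by
      rw [Finsupp.single_le_iff]
      exact Nat.one_le_iff_ne_zero.2 hi
    have e : s = (s - Finsupp.single i 1) + Finsupp.single i 1 := (tsub_add_cancel_of_le hle).symm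
    have e' : MvPolynomial.monomial s c =
        MvPolynomial.monomial (s - Finsupp.single i 1) c * MvPolynomial.X i := by
      rw [MvPolynomial.X, MvPolynomial.monomial_mul, ← e, mul_one]
    rw [e']
    refine evalPoly_mul_X_mem_monicSpan i _ (ih _ ?_)
    rw [e, map_add, Finsupp.degree_single] at hs
    omega

lemma polySpace_le_monicSpan (n : ℕ) : polySpace ρ N n ≤ monicSpan ρ N n := by
  rintro _ ⟨p, hp, rfl⟩
  rw [SetLike.mem_coe, MvPolynomial.mem_restrictTotalDegree] at hp
  rw [MvPolynomial.as_sum p, map_sum]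
  refine Submodule.sum_mem _ fun s hs => ?_
  have hsn : s.degree ≤ n := (MvPolynomial.le_totalDegree hs).trans hp
  exact Submodule.span_mono (Set.image_mono fun α (hα : _ ≤ _) => hα.trans hsn)
    (evalPoly_monomial_mem_monicSpan _ s rfl _)

variable (ρ N)

/-! ### The sampling operator and its triangular action. -/

/-- The operator `f ↦ ∑_{|α| = m} ⟪m_α, f⟫ m_α / (𝛒 ^ α α !)`. -/
noncomputable def sampling (m : ℕ) : FunSpace ρ N →ₗ[ℝ] FunSpace ρ N :=
  ∑ α ∈ indices d m, (rhoPow ρ α * multiFactorial α)⁻¹ •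
    (innerₛₗ ℝ (monicMonomial ρ N α)).smulRight (monicMonomial ρ N α)

lemma sampling_apply (m : ℕ) (f : FunSpace ρ N) :
    sampling ρ N m f = ∑ α ∈ indices d m, (rhoPow ρ α * multiFactorial α)⁻¹ •
      ⟪monicMonomial ρ N α, f⟫_ℝ • monicMonomial ρ N α := by
  simp [sampling, LinearMap.sum_apply]

/-- The factor m_α turns 1/x! into 1/z! with `x = α + z`, and 𝛒^x splits off 𝛒^α. -/
lemma inner_monicMonomial {m : ℕ} (hm : m ≤ N) (α β : Fin (d + 1) → ℕ) (hα : ∑ i, α i = m) :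
    ⟪monicMonomial ρ N α, monicMonomial ρ N β⟫_ℝ = (Nat.factorial N : ℝ) * rhoPow ρ α *
      ∑ z ∈ indices d (N - m), falling (α + z) β * (rhoPow ρ z / multiFactorial z) := by
  rw [inner_def]
  simp only [monicMonomial_apply]
  rw [Finset.sum_coe_sort (indices d N) fun x => falling x α * falling x β * weight ρ N x]
  have h := sum_falling_div_multiFactorial α hα hm
    fun x => (Nat.factorial N : ℝ) * rhoPow ρ x * falling x β
  rw [Finset.mul_sum]
  refine Eq.trans (Finset.sum_congr rfl fun x _ => ?_) (h.trans (Finset.sum_congr rfl fun z _ => ?_))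
  · rw [weight]
    ring
  · rw [rhoPow_add]
    ring

/-- The action of the sampling operator on monic shifted monomials. -/
lemma sampling_monicMonomial {m : ℕ} (hm : m ≤ N) (β : Fin (d + 1) → ℕ) (hβ : ∑ i, β i ≤ m) :
    sampling ρ N m (monicMonomial ρ N β) =
      ∑ γ ∈ Fintype.piFinset fun i => Finset.range (β i + 1),
        ((Nat.factorial N : ℝ) * ((∏ i, (β i).choose (γ i) : ℕ) : ℝ) *
          (∑ z ∈ indices d (N - m), falling z (β - γ) * (rhoPow ρ z / multiFactorial z)) *
          ((N - ∑ i, γ i).choose (m - ∑ i, γ i) : ℝ)) • monicMonomial ρ N γ := by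
  rw [sampling_apply]
  have hinner : ∀ α ∈ indices d m, (rhoPow ρ α * multiFactorial α)⁻¹ •
      ⟪monicMonomial ρ N α, monicMonomial ρ N β⟫_ℝ • monicMonomial ρ N α =
      ∑ γ ∈ Fintype.piFinset fun i => Finset.range (β i + 1),
        ((Nat.factorial N : ℝ) * ((∏ i, (β i).choose (γ i) : ℕ) : ℝ) *
          (∑ z ∈ indices d (N - m), falling z (β - γ) * (rhoPow ρ z / multiFactorial z))) •
          (falling α γ / multiFactorial α) • monicMonomial ρ N α := by
    intro α hα
    rw [inner_monicMonomial ρ N hm α β (Finset.Nat.mem_antidiagonalTuple.1 hα)]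
    simp only [smul_smul]
    rw [← Finset.sum_smul]
    congr 1
    have h1 := (rhoPow_pos ρ α).ne'
    have h2 := (multiFactorial_pos α).ne'
    -- All dependence on `α` is now in `falling α γ`, so the sum over `α` can be done for each `γ`
    -- separately.
    have e : ∑ z ∈ indices d (N - m), falling (α + z) β * (rhoPow ρ z / multiFactorial z) =
        ∑ γ ∈ Fintype.piFinset fun i => Finset.range (β i + 1),
          ((∏ i, (β i).choose (γ i) : ℕ) : ℝ) *
          (∑ z ∈ indices d (N - m), falling z (β - γ) * (rhoPow ρ z / multiFactorial z)) *
            falling α γ := by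
      simp_rw [falling_add_left, Finset.sum_mul, Finset.mul_sum, Finset.sum_mul]
      rw [Finset.sum_comm]
      refine Finset.sum_congr rfl fun γ _ => Finset.sum_congr rfl fun z _ => ?_
      ring
    rw [e, Finset.mul_sum, Finset.mul_sum]
    refine Finset.sum_congr rfl fun γ _ => ?_
    field_simp
  rw [Finset.sum_congr rfl hinner, Finset.sum_comm]
  refine Finset.sum_congr rfl fun γ hγ => ?_
  rw [← Finset.smul_sum]
  conv_rhs => rw [mul_smul]
  congr 1
  have hγβ : ∑ i, γ i ≤ m := (Finset.sum_le_sum fun i _ =>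
    Finset.mem_range_succ_iff.1 (Fintype.mem_piFinset.1 hγ i)).trans hβ
  let ev : (x : indices d N) → FunSpace ρ N →ₗ[ℝ] ℝ := fun x =>
    { toFun := fun f => f x, map_add' := fun _ _ => rfl, map_smul' := fun _ _ => rfl }
  funext x
  have hev := map_sum (ev x)
    (fun α => (falling α γ / multiFactorial α) • monicMonomial ρ N α) (indices d m)
  refine Eq.trans hev ?_
  change ∑ α ∈ indices d m, falling α γ / multiFactorial α * monicMonomial ρ N α x =
    _ * monicMonomial ρ N γ x
  simp only [monicMonomial_apply]
  rw [← sum_falling_mul_falling x.1 γ (Finset.Nat.mem_antidiagonalTuple.1 x.2) rfl hγβ]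
  exact Finset.sum_congr rfl fun α _ => mul_comm _ _

variable {ρ N}

/-! ### The scalar on the degree-`n` component. -/

lemma starProjection_monicMonomial_of_lt {n : ℕ} {α : Fin (d + 1) → ℕ} (h : ∑ i, α i < n) :
    (orthoSpace ρ N n).starProjection (monicMonomial ρ N α) = 0 := by
  rw [Submodule.starProjection_apply_eq_zero_iff, Submodule.mem_orthogonal']
  intro f hf
  have hf' := (Submodule.mem_iInf _).1 ((Submodule.mem_iInf _).1 hf.2 (∑ i, α i)) h
  exact (Submodule.mem_orthogonal _ _).1 hf' _ (monicMonomial_mem_polySpace ρ N α)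

/-- Up to the orthogonal projection, the sampling operator acts on polynomials of degree `n` as
a scalar. -/
lemma starProjection_sampling {n m : ℕ} (hnm : n ≤ m) (hm : m ≤ N) {f : FunSpace ρ N}
    (hf : f ∈ polySpace ρ N n) :
    (orthoSpace ρ N n).starProjection (sampling ρ N m f) =
      ((Nat.factorial N : ℝ) / (Nat.factorial (N - m) : ℝ) * ((N - n).choose (m - n) : ℝ)) •
        (orthoSpace ρ N n).starProjection f := by
  refine Submodule.span_induction (p := fun f _ =>
    (orthoSpace ρ N n).starProjection (sampling ρ N m f) =
      ((Nat.factorial N : ℝ) / (Nat.factorial (N - m) : ℝ) * ((N - n).choose (m - n) : ℝ)) •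
        (orthoSpace ρ N n).starProjection f) ?_ ?_ ?_ ?_ (polySpace_le_monicSpan n hf)
  · rintro _ ⟨β, hβ, rfl⟩
    have hβ' : ∑ i, β i ≤ n := hβ
    rw [sampling_monicMonomial ρ N hm β (hβ'.trans hnm), map_sum]
    -- Any other `γ ≤ β` has total degree below `n`, so its projection vanishes.
    rw [Finset.sum_eq_single β]
    · rw [map_smul]
      rcases hβ'.lt_or_eq with h | h
      · simp [starProjection_monicMonomial_of_lt h]
      -- The diagonal coefficient is a multinomial sum, evaluated using `∑ 𝛒ᵢ = 1`.
      · have hz : ∑ z ∈ indices d (N - m),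
            falling z (β - β) * (rhoPow ρ z / multiFactorial z) =
            1 / (Nat.factorial (N - m) : ℝ) := by
          rw [← sum_rhoPow_div_multiFactorial ρ]
          simp [falling]
        rw [hz, h]
        congr 1
        simp only [Nat.choose_self, Finset.prod_const_one, Nat.cast_one]
        ring
    · intro γ hγ hne
      have hle : γ ≤ β := fun i => Finset.mem_range_succ_iff.1 (Fintype.mem_piFinset.1 hγ i)
      have hlt : ∑ i, γ i < ∑ i, β i := by
        obtain ⟨i, hi⟩ := (Pi.lt_def.1 (lt_of_le_of_ne hle hne)).2
        exact Finset.sum_lt_sum (fun j _ => hle j) ⟨i, Finset.mem_univ i, hi⟩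
      rw [map_smul, starProjection_monicMonomial_of_lt (hlt.trans_le hβ'), smul_zero]
    · intro h
      exact (h (Fintype.mem_piFinset.2 fun i => by simp)).elim
  · simp
  · intro f g _ _ hf hg
    simp only [map_add, hf, hg, smul_add]
  · intro r f _ hf
    simp only [map_smul, hf, smul_comm r]

end

end Krawtchouk

/-! ### The kernel formula. -/

theorem mainTheorem7 (d N n m : ℕ) (ρ : Krawtchouk.params d) (hnm : n ≤ m) (hmN : m ≤ N)
    (x y : Krawtchouk.indices d N) :
    Krawtchouk.kernel ρ N n x y =
      Krawtchouk.poch (-(N : ℝ)) n * (Nat.factorial m : ℝ) /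
          (Krawtchouk.poch (-(m : ℝ)) n * Krawtchouk.poch (-(N : ℝ)) m ^ 2) *
        ∑ α ∈ Krawtchouk.indices d m,
          Krawtchouk.rhoPow ρ α / Krawtchouk.multiFactorial α *
            Krawtchouk.L ρ N α n x * Krawtchouk.L ρ N α n y := by
  open Krawtchouk in
  open scoped InnerProductSpace in
  let k : FunSpace ρ N := fun y => kernel ρ N n x y
  have hk : k ∈ orthoSpace ρ N n := kernel_mem ρ N n x
  have hproj := starProjection_sampling hnm hmN hk.1
  rw [Submodule.starProjection_eq_self_iff.2 hk, sampling_apply, map_sum] at hproj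
  let ev : FunSpace ρ N →ₗ[ℝ] ℝ :=
    { toFun := fun f => f y, map_add' := fun _ _ => rfl, map_smul' := fun _ _ => rfl }
  have hinner : ∀ α, ⟪monicMonomial ρ N α, k⟫_ℝ = rhoPow ρ α * L ρ N α n x := by
    intro α
    -- Self-adjointness moves the projection from `k`, which it fixes, onto m_α, where the
    -- reproducing property applies.
    have h1 : ⟪monicMonomial ρ N α, k⟫_ℝ =
        ⟪(orthoSpace ρ N n).starProjection (monicMonomial ρ N α), k⟫_ℝ := by
      rw [Submodule.inner_starProjection_left_eq_right,
        Submodule.starProjection_eq_self_iff.2 hk]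
    rw [h1, real_inner_comm]
    refine (inner_kernel ρ N n x _ (Submodule.starProjection_apply_mem _ _)).trans ?_
    change _ = rhoPow ρ α * ((rhoPow ρ α)⁻¹ * _)
    rw [mul_inv_cancel_left₀ (rhoPow_pos ρ α).ne']
  have hL : ∀ α, ev ((orthoSpace ρ N n).starProjection (monicMonomial ρ N α)) =
      rhoPow ρ α * L ρ N α n y := by
    intro α
    change _ = rhoPow ρ α * ((rhoPow ρ α)⁻¹ * _)
    rw [mul_inv_cancel_left₀ (rhoPow_pos ρ α).ne']
    rfl
  have hev := congrArg ev hproj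
  simp only [map_sum, map_smul, smul_eq_mul, hinner, hL] at hev
  have hsum : ∑ α ∈ indices d m, rhoPow ρ α / multiFactorial α * L ρ N α n x * L ρ N α n y =
      (Nat.factorial N : ℝ) / (Nat.factorial (N - m) : ℝ) * ((N - n).choose (m - n) : ℝ) *
        kernel ρ N n x y := by
    refine Eq.trans (Finset.sum_congr rfl fun α _ => ?_) hev
    have h1 := (rhoPow_pos ρ α).ne'
    have h2 := (multiFactorial_pos α).ne'
    field_simp
  rw [hsum, ← mul_assoc]
  have hNn := Nat.factorial_mul_descFactorial (hnm.trans hmN)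
  have hmn := Nat.factorial_mul_descFactorial hnm
  have hNm := Nat.factorial_mul_descFactorial hmN
  have hch := Nat.choose_mul_factorial_mul_factorial (Nat.sub_le_sub_right hmN n)
  rw [show N - n - (m - n) = N - m by omega] at hch
  have hNn' : ((N - n).factorial : ℝ) * N.descFactorial n = N.factorial := by exact_mod_cast hNn
  have hmn' : ((m - n).factorial : ℝ) * m.descFactorial n = m.factorial := by exact_mod_cast hmn
  have hNm' : ((N - m).factorial : ℝ) * N.descFactorial m = N.factorial := by exact_mod_cast hNm
  have hch' : ((N - n).choose (m - n) : ℝ) * (m - n).factorial * (N - m).factorial =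
    (N - n).factorial := by exact_mod_cast hch
  have p1 : (m.descFactorial n : ℝ) ≠ 0 := by
    simpa [Nat.descFactorial_eq_zero_iff_lt] using hnm
  have p2 : (N.descFactorial m : ℝ) ≠ 0 := by
    simpa [Nat.descFactorial_eq_zero_iff_lt] using hmN
  have p3 : ((N - m).factorial : ℝ) ≠ 0 := by positivity
  -- The prefactor is the inverse of the eigenvalue: the signs (-1)^n cancel and (-1)^m is squared,
  -- leaving a factorial identity.
  have hconst : poch (-(N : ℝ)) n * (Nat.factorial m : ℝ) /
      (poch (-(m : ℝ)) n * poch (-(N : ℝ)) m ^ 2) *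
      ((Nat.factorial N : ℝ) / (Nat.factorial (N - m) : ℝ) * ((N - n).choose (m - n) : ℝ)) =
      1 := by
    simp only [poch_neg, mul_pow, ← pow_mul, mul_comm m 2]
    rw [pow_mul (-1 : ℝ) 2 m, neg_one_sq, one_pow, one_mul, ← hmn']
    rw [mul_assoc, mul_assoc, mul_div_mul_left _ _ (pow_ne_zero _ (by norm_num)), ← hNm']
    have h3 : (N.descFactorial n : ℝ) * ((N - n).choose (m - n)) * (m - n).factorial =
        N.descFactorial m := by
      apply mul_right_cancel₀ p3
      linear_combination (N.descFactorial n : ℝ) * hch' + hNn' - hNm'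
    field_simp
    linear_combination h3
  rw [hconst, one_mul]
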